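/- Let $K$ be a field of characteristic zero and let $\mathcal A$ be an associative $K$-algebra, not necessarily unital or commutative. A $K$-linear map $\eta:\mathcal A\to\mathcal A$ is called locally finite if for every $a\in\mathcal A$ the $K$-subspace spanned by the elements $\eta^i(a)$ $(i\ge 0)$ is finite dimensional, and locally nilpotent if for every $a\in\mathcal A$ there is $m\ge 1$ with $\eta^m(a)=0$. A $K$-derivation of $\mathcal A$ is a $K$-linear map $D:\mathcal A\to\mathcal A$ with $D(ab)=D(a)b+aD(b)$ for all $a,b\in\mathcal A$. A $K$-$\mathcal E$-derivation of $\mathcal A$ is a $K$-linear map $\delta:\mathcal A\to\mathcal A$ with $\delta(ab)=\delta(a)b+a\delta(b)-\delta(a)\delta(b)$ for all $a,b\in\mathcal A$; equivalently, $\delta=\mathrm{Id}-\phi$ for a (not necessarily unit-preserving) $K$-algebra endomorphism $\phi$ of $\mathcal A$. For $e\in\mathcal A$, let $(e)$ denote the two-sided ideal of $\mathcal A$ generated by $e$. Then the following hold. (1) For every locally finite $K$-derivation $D$ of $\mathcal A$ and every idempotent $e\in\ker D\cap\operatorname{im}D$, we have $(e)\subseteq\operatorname{im}D$. (2) For every locally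 finite $K$-$\mathcal E$-derivation $\delta$ of $\mathcal A$ and every idempotent $e\in\ker\delta\cap\operatorname{im}\delta$, we have $e\mathcal A\subseteq\operatorname{im}\delta$ and $\mathcal Ae\subseteq\operatorname{im}\delta$. If moreover $\delta$ is locally nilpotent, then also $(e)\subseteq\operatorname{im}\delta$. -/

import Mathlib

/-- A `K`-linear endomorphism `η` is locally nilpotent if every vector is killed by some power
`η ^ m`, `m ≥ 1`. -/
def IsLocallyNilpotentEnd {K A : Type*} [Field K] [AddCommGroup A] [Module K A]
    (η : A →ₗ[K] A) : Prop :=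
  ∀ a : A, ∃ m : ℕ, 1 ≤ m ∧ (η ^ m) a = 0

/-- A `K`-linear endomorphism `η` is locally finite if for every vector `a` the `K`-subspace
spanned by `a, η a, η² a, …` is finite dimensional. -/
def IsLocallyFiniteEnd {K A : Type*} [Field K] [AddCommGroup A] [Module K A]
    (η : A →ₗ[K] A) : Prop :=
  ∀ a : A, FiniteDimensional K (Submodule.span K (Set.range fun i : ℕ => (η ^ i) a))

/-- A `K`-linear map `D : A → A` on a (possibly non-unital, non-commutative) algebra is a
`K`-derivation if it satisfies the Leibniz rule. -/
def IsKDerivation {K A : Type*} [Field K] [NonUnitalRing A] [Module K A]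
    (D : A →ₗ[K] A) : Prop :=
  ∀ a b : A, D (a * b) = D a * b + a * D b

/-- A `K`-linear map `δ : A → A` is a `K`-`ℰ`-derivation if it satisfies the twisted Leibniz rule
below; this says exactly that `Id - δ` is multiplicative. -/
def IsKEDerivation {K A : Type*} [Field K] [NonUnitalRing A] [Module K A]
    (δ : A →ₗ[K] A) : Prop :=
  ∀ a b : A, δ (a * b) = δ a * b + a * δ b - δ a * δ b

/-- The `ℰ`-derivations are the maps `Id - φ` with `φ` a (possibly non-unital) `K`-algebra
endomorphism. -/
theorem isKEDerivation_iff_exists {K A : Type*} [Field K] [NonUnitalRing A] [Module K A]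
    (δ : A →ₗ[K] A) :
    IsKEDerivation δ ↔ ∃ φ : A →ₙₐ[K] A, ∀ a : A, δ a = a - φ a := by
  constructor
  · intro h
    refine ⟨{ toFun := fun a => a - δ a, map_smul' := ?_, map_zero' := by simp,
              map_add' := ?_, map_mul' := ?_ }, ?_⟩
    · intro c a; simp [smul_sub]
    · intro a b; simp only [map_add]; abel
    · intro a b
      simp only [h a b, sub_mul, mul_sub]
      abel
    · intro a
      change δ a = a - (a - δ a)
      abel
  · rintro ⟨φ, h⟩ a b
    simp only [h, map_mul, sub_mul, mul_sub]
    abel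

/-! Write `e = D b`. As `D e = 0`, `b` may be replaced by `e * b * e`, and in characteristic zero
`e` then starts an infinite chain `D (c (k + 1)) = c k`, with `c k = b ^ k / k!`. Let `μ k (a ⊗ a')
= a * c k * a'` and let `T` be the action of `D` on `A ⊗ A`. Then `D ∘ μ 0 = μ 0 ∘ T`, and
integration by parts gives `μ k u = D (μ (k + 1) u) - μ (k + 1) (T u)`. By Fitting's lemma on a
finite-dimensional `T`-stable subspace, `u = v + T w` with `v` killed by a power of `T`: the first
identity handles `T w`, the second handles `v` by induction (`mem_range_of_intertwining`). Hence
every `a * e * a'` lies in the range. For `δ = 1 - φ`, take `T = 1 - φ ⊗ φ` and rising binomials in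
place of divided powers. -/

/-- If `T` stabilises a finite-dimensional subspace containing `u`, then `u` is the sum of a vector
killed by a power of `T` and a vector in the range of `T`. -/
theorem exists_pow_apply_eq_zero_and_eq_add {K M : Type*} [Field K] [AddCommGroup M] [Module K M]
    (T : M →ₗ[K] M) (P : Submodule K M) [FiniteDimensional K P] (hP : ∀ x ∈ P, T x ∈ P)
    {u : M} (hu : u ∈ P) : ∃ (n : ℕ) (v w : M), (T ^ n) v = 0 ∧ u = v + T w := by
  let S : P →ₗ[K] P := T.restrict hP
  -- Fitting decomposition of `S`; `n ≥ 1` lets one factor `T` be split off `T ^ n`.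
  obtain ⟨n, hn, hn0⟩ :=
    ((LinearMap.eventually_isCompl_ker_pow_range_pow S).and
      (Filter.eventually_ge_atTop 1)).exists
  have hmem : (⟨u, hu⟩ : P) ∈ LinearMap.ker (S ^ n) ⊔ LinearMap.range (S ^ n) := by
    rw [hn.sup_eq_top]
    trivial
  obtain ⟨v, hv, _, ⟨w, rfl⟩, hvw⟩ := Submodule.mem_sup.mp hmem
  obtain ⟨m, rfl⟩ := Nat.exists_eq_add_of_le' hn0
  have hcoe : ∀ x : P, (((S ^ (m + 1)) x : P) : M) = (T ^ (m + 1)) x := fun x => by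
    rw [Module.End.pow_restrict]
    rfl
  refine ⟨m + 1, v, (T ^ m) w, ?_, ?_⟩
  · rw [← hcoe, LinearMap.mem_ker.mp hv]
    rfl
  · have h := congrArg Subtype.val hvw
    rw [Submodule.coe_add, hcoe, pow_succ'] at h
    exact h.symm

/-- A family of maps `μ k : M → A` which intertwines `T` and `δ` at `k = 0`, and is such that
`μ k u` lies in the range of `δ` as soon as all `μ j (T u)` do, takes values in the range of `δ`
at `k = 0` on every finite-dimensional `T`-stable subspace. -/
theorem mem_range_of_intertwining {K M A : Type*} [Field K] [AddCommGroup M] [Module K M]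
    [AddCommGroup A] [Module K A] (δ : A →ₗ[K] A) (T : M →ₗ[K] M) (μ : ℕ → M →ₗ[K] A)
    (h0 : ∀ u, δ (μ 0 u) = μ 0 (T u))
    (hstep : ∀ k u, (∀ j, μ j (T u) ∈ LinearMap.range δ) → μ k u ∈ LinearMap.range δ)
    (P : Submodule K M) [FiniteDimensional K P] (hP : ∀ x ∈ P, T x ∈ P)
    {u : M} (hu : u ∈ P) : μ 0 u ∈ LinearMap.range δ := by
  have hnil : ∀ (n : ℕ) (v : M), (T ^ n) v = 0 → ∀ k, μ k v ∈ LinearMap.range δ := by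
    intro n
    induction n with
    | zero =>
      intro v hv k
      have hv' : v = 0 := by simpa using hv
      simp [hv']
    | succ n ih =>
      intro v hv k
      exact hstep k v (ih (T v) (by rwa [pow_succ] at hv))
  obtain ⟨n, v, w, hv, rfl⟩ := exists_pow_apply_eq_zero_and_eq_add T P hP hu
  rw [map_add, ← h0]
  exact add_mem (hnil n v hv 0) ⟨_, rfl⟩

/-! ### Sandwich products on `A ⊗ A` and the passage to the ideal -/

open TensorProduct in
/-- The linear map `a ⊗ c ↦ a * x * c`. -/
noncomputable def mulMiddle (K : Type*) {A : Type*} [Field K] [NonUnitalRing A] [Module K A]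
    [IsScalarTower K A A] [SMulCommClass K A A] (x : A) : A ⊗[K] A →ₗ[K] A :=
  LinearMap.mul' K A ∘ₗ LinearMap.rTensor A (LinearMap.mulRight K x)

open TensorProduct in
@[simp]
theorem mulMiddle_tmul (K : Type*) {A : Type*} [Field K] [NonUnitalRing A] [Module K A]
    [IsScalarTower K A A] [SMulCommClass K A A] (x a c : A) :
    mulMiddle K x (a ⊗ₜ[K] c) = a * x * c := by
  simp [mulMiddle]

@[simp]
theorem mulMiddle_zero (K : Type*) {A : Type*} [Field K] [NonUnitalRing A] [Module K A]
    [IsScalarTower K A A] [SMulCommClass K A A] : mulMiddle K (0 : A) = 0 := by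
  ext
  simp

/-- The orbit span of a vector is stable. -/
theorem apply_mem_span_orbit {K A : Type*} [Field K] [AddCommGroup A] [Module K A]
    (η : A →ₗ[K] A) (a : A) {x : A}
    (hx : x ∈ Submodule.span K (Set.range fun i : ℕ => (η ^ i) a)) :
    η x ∈ Submodule.span K (Set.range fun i : ℕ => (η ^ i) a) := by
  induction hx using Submodule.span_induction with
  | mem x h =>
    obtain ⟨i, rfl⟩ := h
    refine Submodule.subset_span ⟨i + 1, ?_⟩
    simp [pow_succ']
  | zero => simp
  | add x y _ _ hx hy => rw [map_add]; exact add_mem hx hy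
  | smul c x _ hx => rw [map_smul]; exact Submodule.smul_mem _ c hx

open TensorProduct in
/-- If `e = c 0` and `δ (c (k + 1)) = c k`, and `T` is an endomorphism of `A ⊗ A` built from a
locally finite `δ` that governs how `δ` acts on the products `a * c k * a'`, then every
`a * e * a'` lies in the range of `δ`. -/
theorem mul_mul_mem_range {K A : Type*} [Field K] [NonUnitalRing A] [Module K A]
    [IsScalarTower K A A] [SMulCommClass K A A] (δ : A →ₗ[K] A) (hδ : IsLocallyFiniteEnd δ)
    (T : A ⊗[K] A →ₗ[K] A ⊗[K] A) (c : ℕ → A)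
    (hT : ∀ V W : Submodule K A, (∀ x ∈ V, δ x ∈ V) → (∀ y ∈ W, δ y ∈ W) →
      ∀ x ∈ V, ∀ y ∈ W, T (x ⊗ₜ y) ∈ Submodule.map₂ (TensorProduct.mk K A A) V W)
    (h0 : ∀ u, δ (mulMiddle K (c 0) u) = mulMiddle K (c 0) (T u))
    (hstep : ∀ k u, (∀ j, mulMiddle K (c j) (T u) ∈ LinearMap.range δ) →
      mulMiddle K (c k) u ∈ LinearMap.range δ)
    (a a' : A) : a * c 0 * a' ∈ LinearMap.range δ := by
  let V := Submodule.span K (Set.range fun i : ℕ => (δ ^ i) a)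
  let W := Submodule.span K (Set.range fun i : ℕ => (δ ^ i) a')
  -- The image of `V ⊗ W` in `A ⊗ A`: finite dimensional and `T`-stable.
  let P := Submodule.map₂ (TensorProduct.mk K A A) V W
  have : FiniteDimensional K V := hδ a
  have : FiniteDimensional K W := hδ a'
  have : FiniteDimensional K P :=
    Module.Finite.iff_fg.mpr
      ((Module.Finite.iff_fg.mp ‹FiniteDimensional K V›).map₂ _
        (Module.Finite.iff_fg.mp ‹FiniteDimensional K W›))
  have hP : P ≤ P.comap T := Submodule.map₂_le.mpr fun x hx y hy =>
    hT V W (fun _ => apply_mem_span_orbit δ a) (fun _ => apply_mem_span_orbit δ a') x hx y hy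
  have ha : a ⊗ₜ[K] a' ∈ P :=
    Submodule.apply_mem_map₂ (TensorProduct.mk K A A)
      (Submodule.subset_span ⟨0, by simp⟩) (Submodule.subset_span ⟨0, by simp⟩)
  have h := mem_range_of_intertwining δ T (fun k => mulMiddle K (c k)) h0 hstep P hP ha
  rwa [mulMiddle_tmul] at h

/-- An additive subgroup containing all `a * e * a'`, for an idempotent `e`, contains the two-sided
ideal generated by `e`. -/
theorem span_singleton_subset_of_mul_mul_mem {A : Type*} [NonUnitalRing A] (R : AddSubgroup A)
    {e : A} (he : IsIdempotentElem e) (h : ∀ a a', a * e * a' ∈ R) :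
    (TwoSidedIdeal.span {e} : Set A) ⊆ R := by
  -- Without a unit, `x` and its left, right and two-sided multiples need separate conditions.
  let I : TwoSidedIdeal A := TwoSidedIdeal.mk'
    {x | x ∈ R ∧ (∀ a, a * x ∈ R) ∧ (∀ a, x * a ∈ R) ∧ ∀ a a', a * x * a' ∈ R}
    (by simp [zero_mem])
    (by
      rintro x y ⟨hx, hx₁, hx₂, hx₃⟩ ⟨hy, hy₁, hy₂, hy₃⟩
      refine ⟨add_mem hx hy, fun a => ?_, fun a => ?_, fun a a' => ?_⟩
      · rw [mul_add]; exact add_mem (hx₁ a) (hy₁ a)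
      · rw [add_mul]; exact add_mem (hx₂ a) (hy₂ a)
      · rw [mul_add, add_mul]; exact add_mem (hx₃ a a') (hy₃ a a'))
    (by
      rintro x ⟨hx, hx₁, hx₂, hx₃⟩
      refine ⟨neg_mem hx, fun a => ?_, fun a => ?_, fun a a' => ?_⟩
      · rw [mul_neg]; exact neg_mem (hx₁ a)
      · rw [neg_mul]; exact neg_mem (hx₂ a)
      · rw [mul_neg, neg_mul]; exact neg_mem (hx₃ a a'))
    (by
      rintro x y ⟨hy, hy₁, hy₂, hy₃⟩
      refine ⟨hy₁ x, fun a => ?_, fun a => hy₃ x a, fun a a' => ?_⟩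
      · rw [← mul_assoc]; exact hy₁ _
      · rw [← mul_assoc]; exact hy₃ _ _)
    (by
      rintro x y ⟨hx, hx₁, hx₂, hx₃⟩
      refine ⟨hx₂ y, fun a => ?_, fun a => ?_, fun a a' => ?_⟩
      · rw [← mul_assoc]; exact hx₃ _ _
      · rw [mul_assoc]; exact hx₂ _
      · rw [← mul_assoc, mul_assoc (a * x)]; exact hx₃ _ _)
  have hee : e * e = e := he
  have heI : e ∈ I := by
    refine (TwoSidedIdeal.mem_mk' ..).mpr ⟨?_, fun a => ?_, fun a => ?_, h⟩
    · simpa [hee] using h e e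
    · simpa [mul_assoc, hee] using h a e
    · simpa [hee] using h e a
  have hle : TwoSidedIdeal.span {e} ≤ I :=
    TwoSidedIdeal.span_le.mpr (Set.singleton_subset_iff.mpr heI)
  intro x hx
  exact ((TwoSidedIdeal.mem_mk' ..).mp (hle hx)).1

/-! ### Infinite chains of antiderivatives of `e` -/

/-- For a derivation `D` with `D b = e`, where `e` is an identity for `b`, the divided
powers of `b` satisfy `D (c (k + 1)) = c k`. -/
theorem IsKDerivation.exists_dividedPower {K A : Type*} [Field K] [CharZero K] [NonUnitalRing A]
    [Module K A] [IsScalarTower K A A] [SMulCommClass K A A] {D : A →ₗ[K] A}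
    (hD : IsKDerivation D) {e b : A} (he : IsIdempotentElem e) (hDb : D b = e)
    (heb : e * b = b) (hbe : b * e = b) :
    ∃ c : ℕ → A, c 0 = e ∧ ∀ k, D (c (k + 1)) = c k := by
  -- `c k = b ^ k / k!`, where `b ^ 0` means `e`.
  let c : ℕ → A := Nat.rec e fun k x => ((k : K) + 1)⁻¹ • (x * b)
  have hc0 : c 0 = e := rfl
  have hcs : ∀ k, c (k + 1) = ((k : K) + 1)⁻¹ • (c k * b) := fun _ => rfl
  clear_value c
  have hce : ∀ k, c k * e = c k := by
    rintro (_ | k)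
    · rw [hc0, he]
    · rw [hcs, smul_mul_assoc, mul_assoc, hbe]
  refine ⟨c, hc0, fun k => ?_⟩
  induction k with
  | zero => simp [hcs, hc0, heb, hDb]
  | succ k ih =>
    have hk : ((k : K) + 1) ≠ 0 := Nat.cast_add_one_ne_zero k
    have hk' : (((k + 1 : ℕ) : K) + 1) ≠ 0 := Nat.cast_add_one_ne_zero (k + 1)
    have hmul : c k * b = ((k : K) + 1) • c (k + 1) := by rw [hcs, smul_inv_smul₀ hk]
    rw [hcs (k + 1), map_smul, hD, ih, hDb, hce (k + 1), hmul, inv_smul_eq_iff₀ hk']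
    push_cast
    module

/-- For a multiplicative map `φ = Id - δ` with `φ b = b - e`, where `e` is an identity
for `b`, the rising binomial polynomials in `b` satisfy `δ (c (k + 1)) = c k`. -/
theorem IsKEDerivation.exists_risingBinomial {K A : Type*} [Field K] [CharZero K]
    [NonUnitalRing A] [Module K A] [IsScalarTower K A A] [SMulCommClass K A A] {δ : A →ₗ[K] A}
    (hδ : IsKEDerivation δ) {e b : A} (he : IsIdempotentElem e) (hδb : δ b = e)
    (heb : e * b = b) (hbe : b * e = b) :
    ∃ c : ℕ → A, c 0 = e ∧ ∀ k, δ (c (k + 1)) = c k := by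
  -- `c k = b (b + e) ⋯ (b + (k - 1) e) / k!`, a chain for the backward difference `b ↦ b - e`.
  let c : ℕ → A := Nat.rec e fun k x => ((k : K) + 1)⁻¹ • (x * b + (k : K) • x)
  have hc0 : c 0 = e := rfl
  have hcs : ∀ k, c (k + 1) = ((k : K) + 1)⁻¹ • (c k * b + (k : K) • c k) := fun _ => rfl
  clear_value c
  have hce : ∀ k, c k * e = c k := by
    intro k
    induction k with
    | zero => rw [hc0, he]
    | succ k ih => rw [hcs, smul_mul_assoc, add_mul, mul_assoc, hbe, smul_mul_assoc, ih]
  refine ⟨c, hc0, fun k => ?_⟩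
  induction k with
  | zero => simp [hcs, hc0, heb, hδb]
  | succ k ih =>
    have hk : ((k : K) + 1) ≠ 0 := Nat.cast_add_one_ne_zero k
    have hk' : (((k + 1 : ℕ) : K) + 1) ≠ 0 := Nat.cast_add_one_ne_zero (k + 1)
    have hmul : c k * b = ((k : K) + 1) • c (k + 1) - (k : K) • c k := by
      rw [hcs, smul_inv_smul₀ hk, add_sub_cancel_right]
    rw [hcs (k + 1), map_smul, map_add, map_smul, hδ, ih, hδb, hce (k + 1), hce k, hmul,
      inv_smul_eq_iff₀ hk']
    push_cast
    module

/-! ### Integration by parts -/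

open TensorProduct in
/-- A locally finite derivation has `a * c 0 * a'` in its range if `c 0` starts an infinite chain
of `D`-antiderivatives. -/
theorem IsKDerivation.mul_mul_mem_range {K A : Type*} [Field K] [NonUnitalRing A] [Module K A]
    [IsScalarTower K A A] [SMulCommClass K A A] {D : A →ₗ[K] A} (hD : IsKDerivation D)
    (hfin : IsLocallyFiniteEnd D) {c : ℕ → A} (hc0 : D (c 0) = 0)
    (hc : ∀ k, D (c (k + 1)) = c k) (a a' : A) : a * c 0 * a' ∈ LinearMap.range D := by
  let T : A ⊗[K] A →ₗ[K] A ⊗[K] A := LinearMap.rTensor A D + LinearMap.lTensor A D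
  have hT : ∀ x y : A, T (x ⊗ₜ y) = D x ⊗ₜ y + x ⊗ₜ D y := fun x y => by simp [T]
  have key : ∀ x u, D (mulMiddle K x u) = mulMiddle K (D x) u + mulMiddle K x (T u) := by
    intro x u
    induction u with
    | zero => simp
    | add u v hu hv => simp only [map_add, hu, hv]; abel
    | tmul y z =>
      simp only [hT, map_add, mulMiddle_tmul, hD (y * x) z, hD y x, add_mul]
      abel
  refine _root_.mul_mul_mem_range D hfin T c ?_ ?_ ?_ a a'
  · intro V W hV hW x hx y hy
    rw [hT]
    exact add_mem (Submodule.apply_mem_map₂ (TensorProduct.mk K A A) (hV x hx) hy)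
      (Submodule.apply_mem_map₂ (TensorProduct.mk K A A) hx (hW y hy))
  · intro u
    rw [key, hc0, mulMiddle_zero]
    simp
  · intro k u h
    have := key (c (k + 1)) u
    rw [hc] at this
    rw [eq_sub_of_add_eq this.symm]
    exact sub_mem ⟨_, rfl⟩ (h _)

open TensorProduct in
/-- A locally finite `ℰ`-derivation has `a * c 0 * a'` in its range if `c 0` starts an infinite
chain of `δ`-antiderivatives. -/
theorem IsKEDerivation.mul_mul_mem_range {K A : Type*} [Field K] [NonUnitalRing A] [Module K A]
    [IsScalarTower K A A] [SMulCommClass K A A] {δ : A →ₗ[K] A} (hδ : IsKEDerivation δ)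
    (hfin : IsLocallyFiniteEnd δ) {c : ℕ → A} (hc0 : δ (c 0) = 0)
    (hc : ∀ k, δ (c (k + 1)) = c k) (a a' : A) : a * c 0 * a' ∈ LinearMap.range δ := by
  -- This is `1 - φ ⊗ φ` for `φ = 1 - δ`.
  let T : A ⊗[K] A →ₗ[K] A ⊗[K] A :=
    LinearMap.rTensor A δ + LinearMap.lTensor A δ - TensorProduct.map δ δ
  have hT : ∀ x y : A, T (x ⊗ₜ y) = δ x ⊗ₜ y + x ⊗ₜ δ y - δ x ⊗ₜ δ y := fun x y => by simp [T]
  have key : ∀ x u, δ (mulMiddle K x u) =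
      mulMiddle K (δ x) u + mulMiddle K x (T u) - mulMiddle K (δ x) (T u) := by
    intro x u
    induction u with
    | zero => simp
    | add u v hu hv => simp only [map_add, hu, hv]; abel
    | tmul y z =>
      simp only [hT, map_add, map_sub, mulMiddle_tmul, hδ (y * x) z, hδ y x, add_mul, sub_mul]
      abel
  refine _root_.mul_mul_mem_range δ hfin T c ?_ ?_ ?_ a a'
  · intro V W hV hW x hx y hy
    rw [hT]
    exact sub_mem (add_mem (Submodule.apply_mem_map₂ (TensorProduct.mk K A A) (hV x hx) hy)
      (Submodule.apply_mem_map₂ (TensorProduct.mk K A A) hx (hW y hy)))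
      (Submodule.apply_mem_map₂ (TensorProduct.mk K A A) (hV x hx) (hW y hy))
  · intro u
    rw [key, hc0, mulMiddle_zero]
    simp
  · intro k u h
    have := key (c (k + 1)) u
    rw [hc] at this
    -- The cross term brings in `c k` as well as `c (k + 1)` at `T u`, so the induction hypothesis
    -- must cover all indices.
    rw [eq_sub_of_add_eq (sub_eq_iff_eq_add.mp this.symm)]
    exact sub_mem (add_mem ⟨_, rfl⟩ (h _)) (h _)

theorem theorem1p2 {K A : Type*} [Field K] [CharZero K]
    [NonUnitalRing A] [Module K A] [IsScalarTower K A A] [SMulCommClass K A A] :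
    (∀ D : A →ₗ[K] A, IsKDerivation D → IsLocallyFiniteEnd D →
      ∀ e : A, IsIdempotentElem e → e ∈ LinearMap.ker D → e ∈ LinearMap.range D →
        (TwoSidedIdeal.span {e} : Set A) ⊆ (LinearMap.range D : Set A)) ∧
    (∀ δ : A →ₗ[K] A, IsKEDerivation δ → IsLocallyFiniteEnd δ →
      ∀ e : A, IsIdempotentElem e → e ∈ LinearMap.ker δ → e ∈ LinearMap.range δ →
        (∀ a : A, e * a ∈ LinearMap.range δ ∧ a * e ∈ LinearMap.range δ) ∧
        (IsLocallyNilpotentEnd δ →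
          (TwoSidedIdeal.span {e} : Set A) ⊆ (LinearMap.range δ : Set A))) := by
  have hone : ∀ {e b : A}, IsIdempotentElem e →
      e * (e * b * e) = e * b * e ∧ e * b * e * e = e * b * e := fun he =>
    ⟨by rw [← mul_assoc, ← mul_assoc, he], by rw [mul_assoc, he]⟩
  refine ⟨?_, ?_⟩
  · rintro D hD hfin e he hker ⟨b, hb⟩
    have hDe : D e = 0 := hker
    -- Since `D e = 0`, `D (e * b * e) = e * D b * e`; the corner element has `e` as identity.
    have hDb : D (e * b * e) = e := by
      rw [hD, hD, hDe, hb, zero_mul, mul_zero, zero_add, add_zero, he, he]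
    obtain ⟨c, rfl, hc⟩ :=
      hD.exists_dividedPower he hDb (hone he).1 (hone he).2
    exact span_singleton_subset_of_mul_mul_mem (LinearMap.range D).toAddSubgroup he
      (hD.mul_mul_mem_range hfin hDe hc)
  · rintro δ hδ hfin e he hker ⟨b, hb⟩
    have hδe : δ e = 0 := hker
    have hδb : δ (e * b * e) = e := by
      rw [hδ, hδ, hδe, hb]
      simp only [zero_mul, mul_zero, zero_add, add_zero, sub_zero]
      rw [he, he]
    obtain ⟨c, rfl, hc⟩ :=
      hδ.exists_risingBinomial he hδb (hone he).1 (hone he).2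
    have hmem := hδ.mul_mul_mem_range hfin hδe hc
    refine ⟨fun a => ⟨?_, ?_⟩, fun _ =>
      span_singleton_subset_of_mul_mul_mem (LinearMap.range δ).toAddSubgroup he hmem⟩
    -- Here `c 0` is `e`, and `e * e * a = e * a`.
    · have h := hmem (c 0) a
      rwa [he] at h
    · have h := hmem a (c 0)
      rwa [mul_assoc, he] at h
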